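/- Let $A$ be a finite dimensional algebra over a field and let $\mathrm{mod}\,A$ be the category of finitely generated right $A$-modules. Let $K_0(A)$ be the abelian group generated by the symbols $[M]$, $M\in\mathrm{mod}\,A$, modulo the relations $[M]=[M']+[M'']$ whenever $M\cong M'\oplus M''$, and $[P]=0$ for $P$ projective. Let $\bar\Omega:K_0(A)\to K_0(A)$ be the endomorphism with $\bar\Omega[M]=[\Omega M]$, where $\Omega M$ is the syzygy of $M$. For $M\in\mathrm{mod}\,A$ let $\langle\mathrm{add}\,M\rangle\subseteq K_0(A)$ be the subgroup generated by the classes of the indecomposable direct summands of $M$. The Igusa--Todorov function is $$\phi(M)=\min\{\,l\in\mathbb N:\ \bar\Omega|_{\bar\Omega^{\,l+s}\langle \mathrm{add}\,M\rangle}\text{ is injective for all } s\in\mathbb N\,\}.$$ Put $\phi\dim(A)=\sup\{\phi(M): M\in\mathrm{mod}\,A\}$ and $\mathrm{findim}(A)=\sup\{\mathrm{pd}(M): M\in\mathrm{mod}\,A,\ \mathrm{pd}(M)<\infty\}$. We say that $A$ has a gap at $\lambda\in\mathbb N$ if $\lambda\le\phi\dim(A)$ and there is no $M\in\mathrm{mod}\,A$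 with $\phi(M)=\lambda$. Theorem. For every gap $\lambda$ of $A$, $$\mathrm{findim}(A)<\lambda<\phi\dim(A).$$ Hence, if $A$ has a gap, then the finitistic dimension conjecture holds for $A$, that is, $\mathrm{findim}(A)<\infty$. -/

import Mathlib

universe u v

namespace IgusaTodorov

section Ring

variable (R : Type u) [Ring R]

/-- A module is indecomposable if it is nonzero and is not the internal direct sum of two
nonzero submodules. -/
def IsIndecomposable (M : Type v) [AddCommGroup M] [Module R M] : Prop :=
  Nontrivial M ∧ ∀ N N' : Submodule R M, IsCompl N N' → N = ⊥ ∨ N' = ⊥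

/-- The relations of `K₀`: `[M] - [M'] - [M'']` whenever `M ≅ M' ⊕ M''`, and `[P]` for each
finitely generated projective module `P`. -/
def K0Relations : Set (FreeAbelianGroup (FGModuleCat.{u} R)) :=
  {x | ∃ M M' M'' : FGModuleCat.{u} R, Nonempty (M ≃ₗ[R] M' × M'') ∧
      x = FreeAbelianGroup.of M - FreeAbelianGroup.of M' - FreeAbelianGroup.of M''} ∪
  {x | ∃ P : FGModuleCat.{u} R, Module.Projective R P ∧ x = FreeAbelianGroup.of P}

/-- The abelian group generated by the symbols `[M]`, with `M` a finitely generated `R`-module,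
modulo the relations above. -/
abbrev K0 : Type (u + 1) :=
  FreeAbelianGroup (FGModuleCat.{u} R) ⧸ AddSubgroup.closure (K0Relations R)

/-- The class `[M]` in `K₀` of a finitely generated module. -/
def K0.cls (M : FGModuleCat.{u} R) : K0 R :=
  QuotientAddGroup.mk (FreeAbelianGroup.of M)

theorem K0.cls_prod {M M' M'' : FGModuleCat.{u} R} (e : M ≃ₗ[R] M' × M'') :
    K0.cls R M = K0.cls R M' + K0.cls R M'' := by
  have h : (QuotientAddGroup.mk (FreeAbelianGroup.of M - FreeAbelianGroup.of M' -
      FreeAbelianGroup.of M'') : K0 R) = 0 :=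
    (QuotientAddGroup.eq_zero_iff _).2
      (AddSubgroup.subset_closure (Or.inl ⟨M, M', M'', ⟨e⟩, rfl⟩))
  have h2 : K0.cls R M - K0.cls R M' - K0.cls R M'' = 0 := h
  rw [sub_sub, sub_eq_zero] at h2
  exact h2

theorem K0.cls_projective (P : FGModuleCat.{u} R) (hP : Module.Projective R P) :
    K0.cls R P = 0 :=
  (QuotientAddGroup.eq_zero_iff _).2 (AddSubgroup.subset_closure (Or.inr ⟨P, hP, rfl⟩))

theorem K0.cls_congr {M N : FGModuleCat.{u} R} (e : M ≃ₗ[R] N) :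
    K0.cls R M = K0.cls R N := by
  have h := K0.cls_prod R (M := M) (M' := N) (M'' := FGModuleCat.of R PUnit.{u + 1})
    (e.trans LinearEquiv.prodUnique.symm)
  rwa [K0.cls_projective R (FGModuleCat.of R PUnit.{u + 1})
    (inferInstanceAs (Module.Projective R PUnit.{u + 1})), add_zero] at h

/-- The subgroup `⟨add M⟩` of `K₀` generated by the classes of the indecomposable direct
summands of `M`. -/
def addSpan (M : FGModuleCat.{u} R) : AddSubgroup (K0 R) :=
  AddSubgroup.closure {x | ∃ N N' : FGModuleCat.{u} R,
    Nonempty (M ≃ₗ[R] N × N') ∧ IsIndecomposable R N ∧ x = K0.cls R N}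

/-- Auxiliary isomorphism for Schanuel's lemma. -/
theorem exists_ker_prod_equiv {P Q M : Type u} [AddCommGroup P] [Module R P]
    [AddCommGroup Q] [Module R Q] [AddCommGroup M] [Module R M] [Module.Projective R Q]
    (f : P →ₗ[R] M) (g : Q →ₗ[R] M) (hf : Function.Surjective f) :
    Nonempty ((LinearMap.ker (f.coprod g)) ≃ₗ[R] (LinearMap.ker f) × Q) := by
  obtain ⟨h, hh⟩ := Module.projective_lifting_property f g hf
  have hh' : ∀ q, f (h q) = g q := fun q => by rw [← hh]; rfl
  refine ⟨{ toFun := fun x => (⟨x.1.1 + h x.1.2, ?_⟩, x.1.2)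
            map_add' := ?_
            map_smul' := ?_
            invFun := fun y => ⟨(y.1.1 - h y.2, y.2), ?_⟩
            left_inv := ?_
            right_inv := ?_ }⟩
  · have h0 : f x.1.1 + g x.1.2 = 0 := x.2
    rw [LinearMap.mem_ker, map_add, hh', h0]
  · intro x y
    ext
    · simp only [Submodule.coe_add, Prod.fst_add, Prod.snd_add, map_add]; abel
    · simp
  · intro r x
    ext <;> simp
  · have := y.1.2
    rw [LinearMap.mem_ker] at this
    simp [hh', this]
  · intro x
    ext <;> simp
  · intro y
    ext <;> simp

variable [IsNoetherianRing R]

/-- The kernel of a linear map out of a finitely generated module, as a finitely generated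
module. -/
def kerFG {P M : Type u} [AddCommGroup P] [Module R P] [Module.Finite R P]
    [AddCommGroup M] [Module R M] (f : P →ₗ[R] M) : FGModuleCat.{u} R :=
  FGModuleCat.of R (LinearMap.ker f)

/-- Schanuel's lemma in `K₀`. -/
theorem cls_ker_eq {P Q M : Type u} [AddCommGroup P] [Module R P] [Module.Finite R P]
    [AddCommGroup Q] [Module R Q] [Module.Finite R Q] [AddCommGroup M] [Module R M]
    [Module.Projective R P] [Module.Projective R Q]
    (f : P →ₗ[R] M) (g : Q →ₗ[R] M) (hf : Function.Surjective f) (hg : Function.Surjective g) :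
    K0.cls R (kerFG R f) = K0.cls R (kerFG R g) := by
  obtain ⟨e₁⟩ := exists_ker_prod_equiv R f g hf
  obtain ⟨e₂⟩ := exists_ker_prod_equiv R g f hg
  have h₁ := K0.cls_prod R (M := kerFG R (f.coprod g)) (M' := kerFG R f)
    (M'' := FGModuleCat.of R Q) e₁
  have h₂ := K0.cls_prod R (M := kerFG R (g.coprod f)) (M' := kerFG R g)
    (M'' := FGModuleCat.of R P) e₂
  rw [K0.cls_projective R (FGModuleCat.of R Q) ‹_›, add_zero] at h₁
  rw [K0.cls_projective R (FGModuleCat.of R P) ‹_›, add_zero] at h₂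
  have e : LinearMap.ker (f.coprod g) ≃ₗ[R] LinearMap.ker (g.coprod f) :=
    (LinearEquiv.prodComm R P Q).ofSubmodules _ _ (by
      ext ⟨q, p⟩
      simp [add_comm])
  rw [← h₁, ← h₂]
  exact K0.cls_congr R (M := kerFG R (f.coprod g)) (N := kerFG R (g.coprod f)) e

/-- A syzygy of `M`: the kernel of a chosen surjection onto `M` from a free module of finite rank.
By Schanuel's lemma its class in `K₀` does not depend on the surjection, so that it is also
the class of the kernel of a projective cover of `M` whenever there is one. -/
noncomputable def syzygy (M : FGModuleCat.{u} R) : FGModuleCat.{u} R :=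
  kerFG R (Module.Finite.exists_fin' R M).choose_spec.choose

theorem cls_syzygy (M : FGModuleCat.{u} R) {P : Type u} [AddCommGroup P] [Module R P]
    [Module.Finite R P] [Module.Projective R P] (f : P →ₗ[R] M) (hf : Function.Surjective f) :
    K0.cls R (syzygy R M) = K0.cls R (kerFG R f) :=
  cls_ker_eq R _ f (Module.Finite.exists_fin' R M).choose_spec.choose_spec hf

theorem cls_syzygy_prod {M M' M'' : FGModuleCat.{u} R} (e : M ≃ₗ[R] M' × M'') :
    K0.cls R (syzygy R M) = K0.cls R (syzygy R M') + K0.cls R (syzygy R M'') := by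
  obtain ⟨m, f, hf⟩ := Module.Finite.exists_fin' R M'
  obtain ⟨n, g, hg⟩ := Module.Finite.exists_fin' R M''
  rw [cls_syzygy R M' f hf, cls_syzygy R M'' g hg,
    cls_syzygy R M (e.symm.toLinearMap ∘ₗ f.prodMap g)
      (e.symm.surjective.comp (hf.prodMap hg))]
  refine K0.cls_prod R (M := kerFG R _) (M' := kerFG R f) (M'' := kerFG R g) ?_
  exact
    { toFun := fun x => (⟨x.1.1, by
          have h := x.2
          simp only [LinearMap.mem_ker, LinearMap.comp_apply, LinearEquiv.coe_coe,
            LinearEquiv.map_eq_zero_iff, LinearMap.prodMap_apply, Prod.mk_eq_zero] at h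
          exact h.1⟩, ⟨x.1.2, by
          have h := x.2
          simp only [LinearMap.mem_ker, LinearMap.comp_apply, LinearEquiv.coe_coe,
            LinearEquiv.map_eq_zero_iff, LinearMap.prodMap_apply, Prod.mk_eq_zero] at h
          exact h.2⟩)
      map_add' := fun _ _ => rfl
      map_smul' := fun _ _ => rfl
      invFun := fun y => ⟨(y.1.1, y.2.1), by
        have h1 : f y.1.1 = 0 := y.1.2
        have h2 : g y.2.1 = 0 := y.2.2
        rw [LinearMap.mem_ker, LinearMap.comp_apply, LinearMap.prodMap_apply, h1, h2]
        exact map_zero _⟩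
      left_inv := fun _ => rfl
      right_inv := fun _ => rfl }

/-- The endomorphism `Ω̄` of `K₀` with `Ω̄ [M] = [Ω M]`. -/
noncomputable def omegaBar : K0 R →+ K0 R :=
  QuotientAddGroup.lift _ (FreeAbelianGroup.lift fun M => K0.cls R (syzygy R M)) (by
    rw [AddSubgroup.closure_le]
    rintro x (⟨M, M', M'', ⟨e⟩, rfl⟩ | ⟨P, hP, rfl⟩)
    · simp [cls_syzygy_prod R e]
    · have h := cls_syzygy R P (LinearMap.id : P →ₗ[R] P) Function.surjective_id
      have h0 : Module.Projective R (LinearMap.ker (LinearMap.id : P →ₗ[R] P)) := by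
        rw [LinearMap.ker_id]; infer_instance
      simp [h, K0.cls_projective R (kerFG R (LinearMap.id : P →ₗ[R] P)) h0])

theorem omegaBar_cls (M : FGModuleCat.{u} R) {P : Type u} [AddCommGroup P] [Module R P]
    [Module.Finite R P] [Module.Projective R P] (f : P →ₗ[R] M) (hf : Function.Surjective f) :
    omegaBar R (K0.cls R M) = K0.cls R (kerFG R f) := by
  rw [← cls_syzygy R M f hf]
  simp [omegaBar, K0.cls]

/-- The Igusa-Todorov function: the least `l` such that `Ω̄` is injective on the subgroup
`Ω̄ ^ (l + s) ⟨add M⟩` for every `s`. -/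
noncomputable def phi (M : FGModuleCat.{u} R) : ℕ :=
  sInf {l : ℕ | ∀ s : ℕ,
    Set.InjOn (omegaBar R) ((omegaBar R)^[l + s] '' (addSpan R M : Set (K0 R)))}

/-- The `φ`-dimension: the supremum of the values of `φ` on finitely generated modules. -/
noncomputable def phiDim : ℕ∞ :=
  ⨆ M : FGModuleCat.{u} R, (phi R M : ℕ∞)

/-- There is a gap at `t` if `t ≤ φdim` and `t` is not a value of `φ`. -/
def IsGap (t : ℕ) : Prop :=
  (t : ℕ∞) ≤ phiDim R ∧ ¬ ∃ M : FGModuleCat.{u} R, phi R M = t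

end Ring

/-- The finitistic dimension: the supremum of the projective dimensions of the finitely generated
modules of finite projective dimension. -/
noncomputable def finDim (R : Type u) [Ring R] : WithBot ℕ∞ :=
  ⨆ (M : FGModuleCat.{u} R) (_ : CategoryTheory.projectiveDimension M.obj ≠ ⊤),
    CategoryTheory.projectiveDimension M.obj

/-- A finite dimensional algebra is right noetherian. -/
theorem isNoetherianRing_mulOpposite (k : Type v) (A : Type u) [Field k] [Ring A] [Algebra k A]
    [Module.Finite k A] : IsNoetherianRing Aᵐᵒᵖ :=
  have : Module.Finite k Aᵐᵒᵖ := Module.Finite.equiv (MulOpposite.opLinearEquiv k : A ≃ₗ[k] Aᵐᵒᵖ)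
  isNoetherian_of_tower k inferInstance

section Algebra

variable (k : Type v) (A : Type u) [Field k] [Ring A] [Algebra k A] [Module.Finite k A]

/-- The `φ`-dimension of a finite dimensional algebra `A`, computed on right modules, that is,
modules over `Aᵐᵒᵖ`. -/
noncomputable def algPhiDim : ℕ∞ :=
  haveI := isNoetherianRing_mulOpposite k A
  phiDim Aᵐᵒᵖ

/-- The algebra `A` has a gap at `t` (for the function `φ` on right modules). -/
def HasGapAt (t : ℕ) : Prop :=
  haveI := isNoetherianRing_mulOpposite k A
  IsGap Aᵐᵒᵖ t

end Algebra

/-- The finitistic dimension of an algebra `A`, computed on right modules. -/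
noncomputable def algFinDim (A : Type u) [Ring A] : WithBot ℕ∞ :=
  finDim Aᵐᵒᵖ

end IgusaTodorov

/-!
The point is that `φ` extends the projective dimension: `φ(M) = pd(M)` whenever `pd(M)` is finite
(`phi_eq_of_hasProjectiveDimensionLE`). If `findim(A) ≥ t ≥ 1`, some module has finite projective
dimension at least `t`, and one of its syzygies has projective dimension exactly `t`
(`exists_hasProjectiveDimensionLE_and_not`); hence `t` is a value of `φ` and not a gap. Nor is `0`
a gap, being the value of `φ` at the zero module. Moreover a finite supremum of natural numbers is
attained, so `φdim(A)` itself is never a gap.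

To compare `φ` with the projective dimension one needs to know that `[M] = 0` in `K₀` only if `M` is
projective (`cls_eq_zero_iff`). Rather than passing through the Krull-Schmidt theorem, the proof
uses, for fixed `M`, the invariant `X ↦ dim Hom(X, M) / {maps that factor through a projective}`.
It is additive in `X` and vanishes on projective modules, so it factors through `K₀`; if it vanishes
at `X = M`, then `id_M` factors through a projective module, so that `M` is projective. By dimension
shifting, `Ω̄ⁿ [M] = 0` if and only if `pd(M) ≤ n`.
-/

open CategoryTheory Module

namespace IgusaTodorov

/-! ### Stable homomorphisms -/

section StableHom

variable (k : Type v) (R : Type u) [Field k] [Ring R]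

/-- The space of `R`-linear maps `X → M` that factor through a projective module. -/
def projHom (X M : Type u) [AddCommGroup X] [Module R X] [AddCommGroup M] [Module R M]
    [Module k M] [SMulCommClass R k M] : Submodule k (X →ₗ[R] M) where
  carrier := {f | ∃ (P : Type u) (_ : AddCommGroup P) (_ : Module R P) (_ : Module.Projective R P)
    (g : X →ₗ[R] P) (h : P →ₗ[R] M), f = h ∘ₗ g}
  add_mem' := by
    rintro _ _ ⟨P, _, _, _, g, h, rfl⟩ ⟨P', _, _, _, g', h', rfl⟩
    exact ⟨P × P', inferInstance, inferInstance, inferInstance, g.prod g', h.coprod h', by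
      ext; simp⟩
  zero_mem' := ⟨PUnit, inferInstance, inferInstance, inferInstance, 0, 0, by simp⟩
  smul_mem' := by
    rintro c _ ⟨P, _, _, _, g, h, rfl⟩
    exact ⟨P, inferInstance, inferInstance, inferInstance, g, c • h, by ext; simp⟩

variable {R}
variable {X X' X'' M : Type u} [AddCommGroup X] [Module R X] [AddCommGroup X'] [Module R X']
  [AddCommGroup X''] [Module R X''] [AddCommGroup M] [Module R M]
  [Module k M] [SMulCommClass R k M]

variable {k} in
theorem comp_mem_projHom {f : X →ₗ[R] M} (hf : f ∈ projHom k R X M) (g : X' →ₗ[R] X) :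
    f ∘ₗ g ∈ projHom k R X' M := by
  obtain ⟨P, _, _, _, a, b, rfl⟩ := hf
  exact ⟨P, inferInstance, inferInstance, inferInstance, a ∘ₗ g, b, rfl⟩

theorem projHom_eq_top [Module.Projective R X] : projHom k R X M = ⊤ :=
  eq_top_iff.2 fun f _ => ⟨X, inferInstance, inferInstance, inferInstance, LinearMap.id, f, rfl⟩

theorem projective_of_projHom_eq_top (h : projHom k R M M = ⊤) : Module.Projective R M := by
  obtain ⟨P, _, _, _, g, h, e⟩ : LinearMap.id ∈ projHom k R M M := h ▸ Submodule.mem_top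
  exact Module.Projective.of_split g h e.symm

variable (R X M) in
/-- The dimension of the space of stable homomorphisms `X → M`. -/
noncomputable def stableHomDim : ℕ :=
  finrank k ((X →ₗ[R] M) ⧸ projHom k R X M)

theorem finite_linearMap [Module.Finite R X] [Module.Finite k M] :
    Module.Finite k (X →ₗ[R] M) := by
  -- A map on `X` is determined by its values on a finite generating set.
  obtain ⟨n, s, hs⟩ := Module.Finite.exists_fin (R := R) (M := X)
  refine Module.Finite.of_injective
    ({ toFun := fun f i => f (s i), map_add' := fun _ _ => rfl, map_smul' := fun _ _ => rfl } :
      (X →ₗ[R] M) →ₗ[k] (Fin n → M)) fun f g h => ?_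
  exact LinearMap.ext_on_range hs fun i => congrFun h i

theorem stableHomDim_prod [Module.Finite R X'] [Module.Finite R X''] [Module.Finite k M]
    (e : X ≃ₗ[R] X' × X'') :
    stableHomDim k R X M = stableHomDim k R X' M + stableHomDim k R X'' M := by
  have := finite_linearMap k (R := R) (X := X') (M := M)
  have := finite_linearMap k (R := R) (X := X'') (M := M)
  let Φ : (X →ₗ[R] M) →ₗ[k]
      ((X' →ₗ[R] M) ⧸ projHom k R X' M) × ((X'' →ₗ[R] M) ⧸ projHom k R X'' M) :=
    ((projHom k R X' M).mkQ ∘ₗ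
      { toFun := fun f => f ∘ₗ e.symm.toLinearMap ∘ₗ LinearMap.inl R X' X''
        map_add' := fun _ _ => rfl
        map_smul' := fun _ _ => rfl }).prod
    ((projHom k R X'' M).mkQ ∘ₗ
      { toFun := fun f => f ∘ₗ e.symm.toLinearMap ∘ₗ LinearMap.inr R X' X''
        map_add' := fun _ _ => rfl
        map_smul' := fun _ _ => rfl })
  have hΦ : ∀ f, Φ f = (Submodule.Quotient.mk (f ∘ₗ e.symm.toLinearMap ∘ₗ LinearMap.inl R X' X''),
      Submodule.Quotient.mk (f ∘ₗ e.symm.toLinearMap ∘ₗ LinearMap.inr R X' X'')) := fun _ => rfl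
  have hsurj : Function.Surjective Φ := by
    rintro ⟨a, b⟩
    obtain ⟨a, rfl⟩ := Submodule.Quotient.mk_surjective _ a
    obtain ⟨b, rfl⟩ := Submodule.Quotient.mk_surjective _ b
    refine ⟨(a.coprod b) ∘ₗ e.toLinearMap, ?_⟩
    rw [hΦ]
    congr 2 <;> ext <;> simp
  have hker : LinearMap.ker Φ = projHom k R X M := by
    ext f
    rw [LinearMap.mem_ker, hΦ, Prod.mk_eq_zero, Submodule.Quotient.mk_eq_zero,
      Submodule.Quotient.mk_eq_zero]
    refine ⟨fun h => ?_, fun h => ⟨comp_mem_projHom h _, comp_mem_projHom h _⟩⟩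
    convert (projHom k R X M).add_mem
      (comp_mem_projHom h.1 (LinearMap.fst R X' X'' ∘ₗ e.toLinearMap))
      (comp_mem_projHom h.2 (LinearMap.snd R X' X'' ∘ₗ e.toLinearMap)) using 1
    ext x
    simp [← map_add]
  rw [stableHomDim, ← hker, (Φ.quotKerEquivOfSurjective hsurj).finrank_eq, finrank_prod]
  rfl

theorem stableHomDim_of_projective [Module.Projective R X] : stableHomDim k R X M = 0 := by
  rw [stableHomDim, projHom_eq_top]
  exact finrank_zero_of_subsingleton

theorem projective_of_stableHomDim_eq_zero [Module.Finite R M] [Module.Finite k M]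
    (h : stableHomDim k R M M = 0) : Module.Projective R M := by
  have := finite_linearMap k (R := R) (X := M) (M := M)
  have := finrank_zero_iff.1 h
  exact projective_of_projHom_eq_top k (Submodule.Quotient.subsingleton_iff.1 this)

end StableHom

/-! ### Vanishing of classes in `K₀` -/

section Vanishing

variable (k : Type v) (R : Type u) [Field k] [Ring R] [Algebra k R] [Module.Finite k R]

include k in
theorem cls_eq_zero_iff (M : FGModuleCat.{u} R) : K0.cls R M = 0 ↔ Module.Projective R M := by
  refine ⟨fun h => ?_, K0.cls_projective R M⟩
  let _ : Module k M := Module.compHom M (algebraMap k R)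
  have : IsScalarTower k R M := IsScalarTower.of_algebraMap_smul fun _ _ => rfl
  have : Module.Finite k M := Module.Finite.trans R M
  have : SMulCommClass R k M := IsScalarTower.to_smulCommClass'
  -- The dimension of stable homomorphisms into `M` factors through `K₀`.
  let χ : K0 R →+ ℤ :=
    QuotientAddGroup.lift _ (FreeAbelianGroup.lift fun X => (stableHomDim k R X M : ℤ)) (by
      rw [AddSubgroup.closure_le]
      rintro x (⟨X, X', X'', ⟨e⟩, rfl⟩ | ⟨P, hP, rfl⟩)
      · simp [stableHomDim_prod k e]
      · simp [stableHomDim_of_projective k (R := R) (X := P) (M := M)])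
  have hχ : χ (K0.cls R M) = (stableHomDim k R M M : ℤ) := by simp [χ, K0.cls]
  rw [h, map_zero] at hχ
  exact projective_of_stableHomDim_eq_zero k (by exact_mod_cast hχ.symm)

end Vanishing

/-! ### Syzygies and projective dimension -/

section Syzygy

variable (R : Type u) [Ring R]

theorem hasProjectiveDimensionLE_zero_iff (M : FGModuleCat.{u} R) :
    HasProjectiveDimensionLE M.obj 0 ↔ Module.Projective R M :=
  (projective_iff_hasProjectiveDimensionLE_zero _).symm.trans
    (IsProjective.iff_projective (R := R) M).symm

variable {R} in
theorem hasProjectiveDimensionLE_of_prod {M N N' : FGModuleCat.{u} R} (e : M ≃ₗ[R] N × N') {n : ℕ}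
    (h : HasProjectiveDimensionLE M.obj n) : HasProjectiveDimensionLE N.obj n :=
  Retract.hasProjectiveDimensionLT (Y := M.obj)
    { i := ModuleCat.ofHom (e.symm.toLinearMap ∘ₗ LinearMap.inl R N N')
      r := ModuleCat.ofHom (LinearMap.fst R N N' ∘ₗ e.toLinearMap)
      retract := by ext; simp } (n + 1)

variable [IsNoetherianRing R]

theorem omegaBar_cls_syzygy (M : FGModuleCat.{u} R) :
    omegaBar R (K0.cls R M) = K0.cls R (syzygy R M) := by
  simp [omegaBar, K0.cls]

theorem hasProjectiveDimensionLE_succ_iff (M : FGModuleCat.{u} R) (n : ℕ) :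
    HasProjectiveDimensionLE M.obj (n + 1) ↔ HasProjectiveDimensionLE (syzygy R M).obj n := by
  have hf := (Module.Finite.exists_fin' R M).choose_spec.choose_spec
  refine (LinearMap.shortExact_shortComplexKer hf).hasProjectiveDimensionLT_X₃_iff n ?_
  exact (IsProjective.iff_projective _).1 inferInstance

/-- A module of finite projective dimension greater than `t` has a syzygy of projective dimension
exactly `t + 1`. -/
theorem exists_hasProjectiveDimensionLE_and_not (t n : ℕ) (M : FGModuleCat.{u} R)
    (hn : HasProjectiveDimensionLE M.obj n) (ht : ¬ HasProjectiveDimensionLE M.obj t) :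
    ∃ N : FGModuleCat.{u} R,
      HasProjectiveDimensionLE N.obj (t + 1) ∧ ¬ HasProjectiveDimensionLE N.obj t := by
  induction n generalizing M with
  | zero => exact absurd (hasProjectiveDimensionLT_of_ge _ 1 (t + 1) (by omega)) ht
  | succ n ih =>
    by_cases h : HasProjectiveDimensionLE M.obj (t + 1)
    · exact ⟨M, h, ht⟩
    · exact ih (syzygy R M) ((hasProjectiveDimensionLE_succ_iff R M n).1 hn)
        (mt (hasProjectiveDimensionLE_succ_iff R M t).2 h)

variable (k : Type v) [Field k] [Algebra k R] [Module.Finite k R]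

include k in
theorem omegaBar_iterate_cls_eq_zero_iff (n : ℕ) (M : FGModuleCat.{u} R) :
    (omegaBar R)^[n] (K0.cls R M) = 0 ↔ HasProjectiveDimensionLE M.obj n := by
  induction n generalizing M with
  | zero => exact (cls_eq_zero_iff k R M).trans (hasProjectiveDimensionLE_zero_iff R M).symm
  | succ n ih =>
    rw [Function.iterate_succ_apply, omegaBar_cls_syzygy, ih, hasProjectiveDimensionLE_succ_iff]

end Syzygy

/-! ### The Igusa-Todorov function on modules of finite projective dimension -/

section Phi

variable (R : Type u) [Ring R] [IsNoetherianRing R]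

/-- A finitely generated module over a noetherian ring is a finite direct sum of indecomposable
modules; therefore its class lies in `⟨add M⟩`. -/
theorem cls_mem_addSpan (M : FGModuleCat.{u} R) : K0.cls R M ∈ addSpan R M := by
  -- Noetherian induction on the complement of a direct summand `N` of `M`.
  have key : ∀ (I : Submodule R M) (N N' : FGModuleCat.{u} R) (e : M ≃ₗ[R] N × N'),
      LinearMap.ker (LinearMap.fst R N N' ∘ₗ e.toLinearMap) = I → K0.cls R N ∈ addSpan R M := by
    intro I
    induction I using IsNoetherian.induction with
    | hgt I ih =>
    intro N N' e hI
    rcases subsingleton_or_nontrivial N with hN | hN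
    · rw [K0.cls_projective R N inferInstance]
      exact zero_mem _
    by_cases hind : IsIndecomposable R N
    · exact AddSubgroup.subset_closure ⟨N, N', ⟨e⟩, hind, rfl⟩
    have main : ∀ L L' : Submodule R N, IsCompl L L' → L' ≠ ⊥ →
        K0.cls R (FGModuleCat.of R L) ∈ addSpan R M := by
      intro L L' hL hne
      let d : N ≃ₗ[R] L × L' := (Submodule.prodEquivOfIsCompl L L' hL).symm
      let e' : M ≃ₗ[R] L × (L' × N') :=
        e.trans ((d.prodCongr (LinearEquiv.refl R N')).trans (LinearEquiv.prodAssoc R L L' N'))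
      have he' : ∀ x, (e' x).1 = (d (e x).1).1 := fun _ => rfl
      refine ih _ ?_ (FGModuleCat.of R L) (FGModuleCat.of R (L' × N')) e' rfl
      subst hI
      refine lt_of_le_of_ne (fun x hx => ?_) fun h => ?_
      · have hx : (e x).1 = 0 := hx
        change (e' x).1 = 0
        rw [he', hx, map_zero, Prod.fst_zero]
      · obtain ⟨y, hy, hy0⟩ := Submodule.exists_mem_ne_zero_of_ne_bot hne
        have hd : d y = (0, ⟨y, hy⟩) :=
          (LinearEquiv.symm_apply_eq _).2 (by simp [Submodule.coe_prodEquivOfIsCompl'])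
        have hmem : e.symm (y, 0) ∈
            LinearMap.ker (LinearMap.fst R N N' ∘ₗ e.toLinearMap) := by
          rw [h]
          change (e' (e.symm (y, 0))).1 = 0
          rw [he', LinearEquiv.apply_symm_apply, hd]
        refine hy0 ?_
        simpa using hmem
    obtain ⟨L, L', hL, h, h'⟩ : ∃ L L' : Submodule R N, IsCompl L L' ∧ L ≠ ⊥ ∧ L' ≠ ⊥ := by
      by_contra! hc
      exact hind ⟨hN, fun L L' hL => or_iff_not_imp_left.2 (hc L L' hL)⟩
    rw [K0.cls_prod R (M := N) (M' := FGModuleCat.of R L) (M'' := FGModuleCat.of R L')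
      (Submodule.prodEquivOfIsCompl L L' hL).symm]
    exact add_mem (main L L' hL h') (main L' L hL.symm h)
  exact key _ M (FGModuleCat.of R PUnit.{u + 1}) LinearEquiv.prodUnique.symm rfl

variable (k : Type v) [Field k] [Algebra k R] [Module.Finite k R]

include k in
theorem omegaBar_iterate_eq_zero_of_mem_addSpan {M : FGModuleCat.{u} R} {n : ℕ}
    (h : HasProjectiveDimensionLE M.obj n) {x : K0 R} (hx : x ∈ addSpan R M) :
    (omegaBar R)^[n] x = 0 := by
  induction hx using AddSubgroup.closure_induction with
  | mem x hx =>
    obtain ⟨N, N', ⟨e⟩, -, rfl⟩ := hx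
    exact (omegaBar_iterate_cls_eq_zero_iff R k n N).2 (hasProjectiveDimensionLE_of_prod e h)
  | zero => exact iterate_map_zero _ n
  | add x y _ _ hx hy => rw [iterate_map_add, hx, hy, add_zero]
  | neg x _ hx => rw [iterate_map_neg, hx, neg_zero]

include k in
/-- `φ(M) = pd(M)` if `pd(M) = n` is finite (or if `M = 0` and `n = 0`): on the one hand
`Ω̄ⁿ ⟨add M⟩ = 0`, on the other `Ω̄ⁿ⁻¹ [M]` is a nonzero element of the kernel of `Ω̄`. -/
theorem phi_eq_of_hasProjectiveDimensionLE {M : FGModuleCat.{u} R} {n : ℕ}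
    (hn : HasProjectiveDimensionLE M.obj n) (hlt : ∀ m < n, ¬ HasProjectiveDimensionLE M.obj m) :
    phi R M = n := by
  refine IsLeast.csInf_eq ⟨?_, ?_⟩
  · rintro s _ ⟨x, hx, rfl⟩ _ ⟨y, hy, rfl⟩ -
    rw [add_comm, Function.iterate_add_apply, Function.iterate_add_apply,
      omegaBar_iterate_eq_zero_of_mem_addSpan R k hn hx,
      omegaBar_iterate_eq_zero_of_mem_addSpan R k hn hy]
  · intro l hl
    by_contra! hln
    obtain ⟨s, rfl⟩ := Nat.exists_eq_add_of_le hln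
    refine hlt (l + s) (by omega) ((omegaBar_iterate_cls_eq_zero_iff R k (l + s) M).1 ?_)
    refine hl s ⟨_, cls_mem_addSpan R M, rfl⟩ ⟨0, zero_mem _, iterate_map_zero _ _⟩ ?_
    rw [map_zero, ← Function.iterate_succ_apply' (omegaBar R),
      omegaBar_iterate_cls_eq_zero_iff R k]
    rwa [show (l + s).succ = l.succ + s by omega]

include k in
/-- Every natural number up to the finitistic dimension is a value of `φ`. -/
theorem exists_phi_eq_of_le_finDim {t : ℕ} (h : ((t : ℕ∞) : WithBot ℕ∞) ≤ finDim R) :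
    ∃ M : FGModuleCat.{u} R, phi R M = t := by
  cases t with
  | zero =>
    refine ⟨FGModuleCat.of R PUnit.{u + 1}, phi_eq_of_hasProjectiveDimensionLE R k ?_ (by simp)⟩
    exact (hasProjectiveDimensionLE_zero_iff R _).2
      (inferInstanceAs (Module.Projective R PUnit.{u + 1}))
  | succ t =>
    obtain ⟨M, hM, ht⟩ : ∃ M : FGModuleCat.{u} R, projectiveDimension M.obj ≠ ⊤ ∧
        ¬ HasProjectiveDimensionLE M.obj t := by
      by_contra! hc
      have hle : finDim R ≤ ((t : ℕ) : WithBot ℕ∞) :=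
        iSup₂_le fun M hM => (projectiveDimension_le_iff _ _).2 (hc M hM)
      have := h.trans hle
      norm_cast at this
      omega
    obtain ⟨n, hn⟩ := (projectiveDimension_ne_top_iff _).1 hM
    obtain ⟨N, hN, hN'⟩ := exists_hasProjectiveDimensionLE_and_not R t n M hn ht
    exact ⟨N, phi_eq_of_hasProjectiveDimensionLE R k hN fun m hm hm' =>
      hN' (hasProjectiveDimensionLT_of_ge _ _ _ (Nat.succ_le_succ (Nat.le_of_lt_succ hm)))⟩

end Phi

/-! ### Gaps -/

section Gap

variable (R : Type u) [Ring R] [IsNoetherianRing R]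

theorem IsGap.lt_phiDim {t : ℕ} (h : IsGap R t) : (t : ℕ∞) < phiDim R := by
  refine lt_of_le_of_ne h.1 fun heq => h.2 ?_
  obtain ⟨M, hM⟩ := ENat.exists_eq_iSup_of_lt_top (f := fun M : FGModuleCat.{u} R => (phi R M : ℕ∞))
    (lt_of_eq_of_lt heq.symm (ENat.natCast_lt_top t))
  exact ⟨M, by exact_mod_cast hM.trans heq.symm⟩

variable (k : Type v) [Field k] [Algebra k R] [Module.Finite k R]

include k in
theorem IsGap.finDim_lt {t : ℕ} (h : IsGap R t) : finDim R < ((t : ℕ∞) : WithBot ℕ∞) :=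
  lt_of_not_ge fun hle => h.2 (exists_phi_eq_of_le_finDim R k hle)

end Gap

end IgusaTodorov

theorem mainTheorem2 {k : Type v} {A : Type u} [Field k] [Ring A] [Algebra k A]
    [Module.Finite k A] :
    (∀ t : ℕ, IgusaTodorov.HasGapAt k A t →
      IgusaTodorov.algFinDim A < ((t : ℕ∞) : WithBot ℕ∞) ∧
        (t : ℕ∞) < IgusaTodorov.algPhiDim k A) ∧
    ((∃ t : ℕ, IgusaTodorov.HasGapAt k A t) → IgusaTodorov.algFinDim A < ⊤) := by
  have := IgusaTodorov.isNoetherianRing_mulOpposite k A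
  have : Module.Finite k Aᵐᵒᵖ :=
    Module.Finite.equiv (MulOpposite.opLinearEquiv k : A ≃ₗ[k] Aᵐᵒᵖ)
  have main : ∀ t : ℕ, IgusaTodorov.HasGapAt k A t →
      IgusaTodorov.algFinDim A < ((t : ℕ∞) : WithBot ℕ∞) ∧
        (t : ℕ∞) < IgusaTodorov.algPhiDim k A := fun t ht =>
    ⟨IgusaTodorov.IsGap.finDim_lt Aᵐᵒᵖ k ht, IgusaTodorov.IsGap.lt_phiDim Aᵐᵒᵖ ht⟩
  exact ⟨main, fun ⟨t, ht⟩ => lt_of_lt_of_le (main t ht).1 le_top⟩
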